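/- Let $n\ge 0$ and let $\mathcal S_n$ be the space of real symmetric $n\times n$ matrices with the scalar product $\langle A,B\rangle=\operatorname{tr}(AB)$ and the Löwner order: $A\preceq B$ if and only if $B-A$ is positive semidefinite. For a set $\mathcal Q\subset\mathcal S_n$ let $\operatorname{ub}(\mathcal Q)=\{X\in\mathcal S_n : A\preceq X \text{ for all } A\in\mathcal Q\}$ be its set of upper bounds; $X$ is a \emph{minimal upper bound} of $\mathcal Q$ if $X\in\operatorname{ub}(\mathcal Q)$ and every $Z\in\operatorname{ub}(\mathcal Q)$ with $Z\preceq X$ equals $X$. \textbf{Theorem.} Let $\mathcal Q\subset\mathcal S_n$ be finite. (i) A matrix $X$ is a minimal upper bound of $\mathcal Q$ if and only if there is a symmetric positive definite matrix $C$ such that $X$ belongs to $\operatorname{ub}(\mathcal Q)$ and minimizes $Z\mapsto\langle C,Z\rangle$ over $\operatorname{ub}(\mathcal Q)$. (ii) If $\mathcal Q$ is nonempty, then for every symmetric positive definite matrix $C$ the map $Z\mapsto\langle C,Z\rangle$ has exactly one minimizer $X_C$ over $\operatorname{ub}(\mathcal Q)$. (iii) If $\mathcal Q=\{P,Q\}$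 with $P,Q\in\mathcal S_n$, then for every symmetric positive definite matrix $C$ this minimizer is $$X_C=\frac{P+Q}{2}+\frac12\,C^{-1/2}\,\bigl|C^{1/2}(P-Q)C^{1/2}\bigr|\,C^{-1/2},$$ where $C^{1/2}$ is the unique positive definite matrix with square $C$, $C^{-1/2}$ is its inverse, and $|M|=(MM^{\top})^{1/2}$ is the unique positive semidefinite matrix with square $MM^{\top}$. -/

import Mathlib

open scoped MatrixOrder

noncomputable section

namespace Loewner

/-- The set of upper bounds, among the real symmetric matrices of size `n` with the Löwner order
(`A ≤ B` iff `B - A` is positive semidefinite), of a set of matrices. -/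
def ub {n : ℕ} (𝒬 : Set (Matrix (Fin n) (Fin n) ℝ)) : Set (Matrix (Fin n) (Fin n) ℝ) :=
  {X | X.IsSymm ∧ ∀ A ∈ 𝒬, A ≤ X}

/-- The set of minimal upper bounds. -/
def minimalUpperBounds {n : ℕ} (𝒬 : Set (Matrix (Fin n) (Fin n) ℝ)) :
    Set (Matrix (Fin n) (Fin n) ℝ) :=
  {X | Minimal (fun Z => Z ∈ ub 𝒬) X}

/-- The Frobenius scalar product of two symmetric matrices. -/
def frob {n : ℕ} (A B : Matrix (Fin n) (Fin n) ℝ) : ℝ :=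
  (A * B).trace

/-- `X` is an upper bound which minimizes `Z ↦ ⟨C, Z⟩` over all upper bounds. -/
def IsMinimizer {n : ℕ} (C : Matrix (Fin n) (Fin n) ℝ) (𝒬 : Set (Matrix (Fin n) (Fin n) ℝ))
    (X : Matrix (Fin n) (Fin n) ℝ) : Prop :=
  X ∈ ub 𝒬 ∧ ∀ Z ∈ ub 𝒬, frob C X ≤ frob C Z

/-- The square root of a positive semidefinite matrix. -/
def msqrt {n : ℕ} (A : Matrix (Fin n) (Fin n) ℝ) : Matrix (Fin n) (Fin n) ℝ :=
  CFC.sqrt A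

/-- The absolute value `(A Aᵀ)^{1/2}`. -/
def mabs {n : ℕ} (A : Matrix (Fin n) (Fin n) ℝ) : Matrix (Fin n) (Fin n) ℝ :=
  msqrt (A * A.transpose)

/-- For a positive semidefinite matrix, `msqrt` is the unique positive semidefinite solution of
`S * S = A`. -/
theorem msqrt_eq_iff {n : ℕ} {A S : Matrix (Fin n) (Fin n) ℝ} (hA : A.PosSemidef) :
    msqrt A = S ↔ S.PosSemidef ∧ S * S = A := by
  constructor
  · rintro rfl
    exact ⟨Matrix.nonneg_iff_posSemidef.mp (CFC.sqrt_nonneg A),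
      CFC.sqrt_mul_sqrt_self A (Matrix.nonneg_iff_posSemidef.mpr hA)⟩
  · rintro ⟨hS, h⟩
    exact CFC.sqrt_unique h (Matrix.nonneg_iff_posSemidef.mpr hS)

/-- For a positive definite matrix, `msqrt` is the unique positive definite solution of
`S * S = A`. -/
theorem msqrt_eq_iff_posDef {n : ℕ} {A S : Matrix (Fin n) (Fin n) ℝ} (hA : A.PosDef) :
    msqrt A = S ↔ S.PosDef ∧ S * S = A := by
  rw [msqrt_eq_iff hA.posSemidef]
  refine ⟨fun ⟨hS, h⟩ => ⟨?_, h⟩, fun ⟨hS, h⟩ => ⟨hS.posSemidef, h⟩⟩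
  refine hS.posDef_iff_isUnit.mpr ?_
  have hu : IsUnit (S * S) := h ▸ hA.isUnit
  rw [Matrix.isUnit_iff_isUnit_det, Matrix.det_mul] at hu
  exact (Matrix.isUnit_iff_isUnit_det S).mpr (isUnit_of_mul_isUnit_left hu)

end Loewner

end

open Matrix

namespace Loewner

variable {n : ℕ}

/-! Pairing with a positive definite `C` is strictly monotone, so its minimizers are minimal.
Conversely, let `X` be minimal. A nonzero `v` in the range of every `X - A` would let a small
multiple of `v vᵀ` be subtracted from `X`; hence these ranges meet only in zero
(`eq_zero_of_forall_mem_range`), the kernels of the `X - A` span, and the sum `C` of the kernel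
projections is positive definite. Each projection annihilates its `X - A`, so `X` minimizes every
summand of the pairing at once.

Uniqueness applies the same fact to the midpoint of two minimizers; existence is compactness. For
two matrices, the spectral projections of `C^{1/2}(P-Q)C^{1/2}` give a lower bound which the formula
attains. -/

lemma isHermitian_iff_isSymm {S : Matrix (Fin n) (Fin n) ℝ} : S.IsHermitian ↔ S.IsSymm := by
  rw [Matrix.IsHermitian, Matrix.IsSymm, conjTranspose_eq_transpose_of_trivial]

/-! ### Spectral calculus -/

lemma exists_orthogonal_diagonalization {S : Matrix (Fin n) (Fin n) ℝ} (hS : S.IsSymm) :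
    ∃ (U : Matrix (Fin n) (Fin n) ℝ) (d : Fin n → ℝ),
      U * Uᵀ = 1 ∧ Uᵀ * U = 1 ∧ S = U * diagonal d * Uᵀ := by
  have hH := isHermitian_iff_isSymm.mpr hS
  refine ⟨hH.eigenvectorUnitary, hH.eigenvalues, ?_, ?_, ?_⟩
  · have := Unitary.mul_star_self_of_mem hH.eigenvectorUnitary.2
    rwa [star_eq_conjTranspose, conjTranspose_eq_transpose_of_trivial] at this
  · have := Unitary.star_mul_self_of_mem hH.eigenvectorUnitary.2
    rwa [star_eq_conjTranspose, conjTranspose_eq_transpose_of_trivial] at this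
  · have := hH.spectral_theorem
    rw [Unitary.conjStarAlgAut_apply, star_eq_conjTranspose,
      conjTranspose_eq_transpose_of_trivial] at this
    exact this

lemma conj_diagonal_mul {U : Matrix (Fin n) (Fin n) ℝ} (hU : Uᵀ * U = 1) (d e : Fin n → ℝ) :
    U * diagonal d * Uᵀ * (U * diagonal e * Uᵀ) = U * diagonal (fun i => d i * e i) * Uᵀ := by
  calc _ = U * diagonal d * (Uᵀ * U) * diagonal e * Uᵀ := by simp only [Matrix.mul_assoc]
    _ = _ := by rw [hU, Matrix.mul_one, Matrix.mul_assoc U, diagonal_mul_diagonal]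

lemma conj_diagonal_add (U : Matrix (Fin n) (Fin n) ℝ) (d e : Fin n → ℝ) :
    U * diagonal d * Uᵀ + U * diagonal e * Uᵀ = U * diagonal (fun i => d i + e i) * Uᵀ := by
  rw [← Matrix.add_mul, ← Matrix.mul_add, diagonal_add]

lemma conj_diagonal_sub (U : Matrix (Fin n) (Fin n) ℝ) (d e : Fin n → ℝ) :
    U * diagonal d * Uᵀ - U * diagonal e * Uᵀ = U * diagonal (fun i => d i - e i) * Uᵀ := by
  rw [← Matrix.sub_mul, ← Matrix.mul_sub, diagonal_sub]

lemma posSemidef_conj {M : Matrix (Fin n) (Fin n) ℝ} (hM : M.PosSemidef)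
    (U : Matrix (Fin n) (Fin n) ℝ) : (U * M * Uᵀ).PosSemidef := by
  simpa [conjTranspose_eq_transpose_of_trivial] using hM.mul_mul_conjTranspose_same U

lemma posSemidef_conj_diagonal (U : Matrix (Fin n) (Fin n) ℝ) {d : Fin n → ℝ}
    (hd : ∀ i, 0 ≤ d i) : (U * diagonal d * Uᵀ).PosSemidef :=
  posSemidef_conj (posSemidef_diagonal_iff.mpr hd) U

/-- The kernel projection `P` and the pseudoinverse `T` of a symmetric matrix. -/
lemma exists_kernel_projection {S : Matrix (Fin n) (Fin n) ℝ} (hS : S.IsSymm) :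
    ∃ P T : Matrix (Fin n) (Fin n) ℝ, P.PosSemidef ∧ P * S = 0 ∧ S * P = 0 ∧ S * T + P = 1 := by
  obtain ⟨U, d, h1, h2, rfl⟩ := exists_orthogonal_diagonalization hS
  refine ⟨U * diagonal (fun i => if d i = 0 then 1 else 0) * Uᵀ,
    U * diagonal (fun i => (d i)⁻¹) * Uᵀ, ?_, ?_, ?_, ?_⟩
  · refine posSemidef_conj_diagonal U fun i => ?_
    split_ifs <;> norm_num
  · have : (fun i => (if d i = 0 then (1 : ℝ) else 0) * d i) = 0 := by
      funext i
      by_cases h : d i = 0 <;> simp [h]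
    rw [conj_diagonal_mul h2, this]
    simp
  · have : (fun i => d i * if d i = 0 then (1 : ℝ) else 0) = 0 := by
      funext i
      by_cases h : d i = 0 <;> simp [h]
    rw [conj_diagonal_mul h2, this]
    simp
  · rw [conj_diagonal_mul h2, conj_diagonal_add]
    have : (fun i => d i * (d i)⁻¹ + if d i = 0 then (1 : ℝ) else 0) = fun _ => 1 := by
      funext i
      by_cases h : d i = 0 <;> simp [h]
    rw [this, diagonal_one, Matrix.mul_one, h1]

/-- The absolute value of a symmetric matrix through its two complementary spectral projections. -/
lemma exists_mabs_decomposition {D : Matrix (Fin n) (Fin n) ℝ} (hD : D.IsSymm) :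
    ∃ E F : Matrix (Fin n) (Fin n) ℝ, E.PosSemidef ∧ F.PosSemidef ∧ E + F = 1 ∧
      mabs D = E * D - F * D ∧ D ≤ mabs D ∧ -D ≤ mabs D ∧ 0 ≤ mabs D := by
  obtain ⟨U, d, h1, h2, rfl⟩ := exists_orthogonal_diagonalization hD
  have habs : mabs (U * diagonal d * Uᵀ) = U * diagonal (fun i => |d i|) * Uᵀ := by
    unfold mabs
    rw [hD.eq, msqrt_eq_iff]
    · refine ⟨posSemidef_conj_diagonal U fun i => abs_nonneg _, ?_⟩
      rw [conj_diagonal_mul h2, conj_diagonal_mul h2]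
      simp
    · rw [conj_diagonal_mul h2]
      exact posSemidef_conj_diagonal U fun i => mul_self_nonneg _
  refine ⟨U * diagonal (fun i => if 0 ≤ d i then 1 else 0) * Uᵀ,
    U * diagonal (fun i => if 0 ≤ d i then 0 else 1) * Uᵀ, ?_, ?_, ?_, ?_, ?_, ?_, ?_⟩
  · refine posSemidef_conj_diagonal U fun i => ?_
    split_ifs <;> norm_num
  · refine posSemidef_conj_diagonal U fun i => ?_
    split_ifs <;> norm_num
  · rw [conj_diagonal_add]
    have : (fun i => (if 0 ≤ d i then (1 : ℝ) else 0) + if 0 ≤ d i then (0 : ℝ) else 1)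
        = fun _ => 1 := by
      funext i
      split_ifs <;> norm_num
    rw [this, diagonal_one, Matrix.mul_one, h1]
  · rw [habs, conj_diagonal_mul h2, conj_diagonal_mul h2, conj_diagonal_sub]
    congr 3
    funext i
    split_ifs with h
    · simp [abs_of_nonneg h]
    · simp [abs_of_neg (not_le.mp h)]
  · rw [habs, Matrix.le_iff, conj_diagonal_sub]
    exact posSemidef_conj_diagonal U fun i => sub_nonneg.mpr (le_abs_self _)
  · rw [habs, Matrix.le_iff, sub_neg_eq_add, conj_diagonal_add]
    exact posSemidef_conj_diagonal U fun i => by linarith [neg_abs_le (d i)]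
  · rw [habs, Matrix.nonneg_iff_posSemidef]
    exact posSemidef_conj_diagonal U fun i => abs_nonneg _

lemma exists_posDef_sqrt {C : Matrix (Fin n) (Fin n) ℝ} (hC : C.PosDef) :
    (msqrt C).PosDef ∧ msqrt C * msqrt C = C :=
  (msqrt_eq_iff_posDef hC).mp rfl

lemma transpose_eq_of_posDef {B : Matrix (Fin n) (Fin n) ℝ} (hB : B.PosDef) : Bᵀ = B :=
  isHermitian_iff_isSymm.mp hB.isHermitian

/-! ### The scalar product and positive semidefinite matrices -/

lemma frob_mul_self (B M : Matrix (Fin n) (Fin n) ℝ) : frob (B * B) M = (B * M * B).trace := by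
  unfold frob
  rw [Matrix.mul_assoc, trace_mul_comm, Matrix.mul_assoc]

lemma frob_nonneg {C M : Matrix (Fin n) (Fin n) ℝ} (hC : C.PosSemidef) (hM : M.PosSemidef) :
    0 ≤ frob C M := by
  have h := (msqrt_eq_iff hC).mp rfl
  have hT : (msqrt C)ᵀ = msqrt C := isHermitian_iff_isSymm.mp h.1.isHermitian
  have := (posSemidef_conj hM (msqrt C)).trace_nonneg
  rwa [hT, ← frob_mul_self, h.2] at this

/-- With `B * B = C`, the matrix `B * M * B` is positive semidefinite of trace `frob C M`, hence
zero, and `B` is invertible. -/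
lemma eq_zero_of_frob_nonpos {C M : Matrix (Fin n) (Fin n) ℝ} (hC : C.PosDef)
    (hM : M.PosSemidef) (h : frob C M ≤ 0) : M = 0 := by
  obtain ⟨hB, hBC⟩ := exists_posDef_sqrt hC
  set B := msqrt C
  have hp := posSemidef_conj hM B
  rw [transpose_eq_of_posDef hB] at hp
  have h0 : B * M * B = 0 := by
    rw [← hp.trace_eq_zero_iff, ← frob_mul_self, hBC]
    exact le_antisymm h (frob_nonneg hC.posSemidef hM)
  have hM' : B * M = 0 := hB.isUnit.mul_left_eq_zero.mp h0
  exact hB.isUnit.mul_right_eq_zero.mp hM'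

lemma frob_sub (C A B : Matrix (Fin n) (Fin n) ℝ) : frob C (A - B) = frob C A - frob C B := by
  simp [frob, Matrix.mul_sub]

lemma frob_add (C A B : Matrix (Fin n) (Fin n) ℝ) : frob C (A + B) = frob C A + frob C B := by
  simp [frob, Matrix.mul_add]

lemma frob_smul (C A : Matrix (Fin n) (Fin n) ℝ) (t : ℝ) : frob C (t • A) = t * frob C A := by
  simp [frob]

/-- Testing on `e_i ± e_j` bounds twice the entry by two diagonal entries. This confines sublevel
sets to a box. -/
lemma abs_apply_le_trace {M : Matrix (Fin n) (Fin n) ℝ} (hM : M.PosSemidef) (i j : Fin n) :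
    |M i j| ≤ M.trace := by
  have hdiag : ∀ k, M k k ≤ M.trace := fun k =>
    Finset.single_le_sum (f := fun k => M k k) (fun k _ => hM.diag_nonneg) (Finset.mem_univ k)
  have hs : M j i = M i j := (isHermitian_iff_isSymm.mp hM.isHermitian).apply i j
  have h1 := hM.dotProduct_mulVec_nonneg (Pi.single i 1 + Pi.single j 1)
  have h2 := hM.dotProduct_mulVec_nonneg (Pi.single i 1 - Pi.single j 1)
  simp [mulVec_add, mulVec_sub, hs] at h1 h2
  rw [abs_le]
  constructor <;> linarith [hdiag i, hdiag j]

/-- For `S` positive semidefinite, all small nonnegative multiples of `(S w)(S w)ᵀ` are below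
`S`. -/
lemma exists_smul_vecMulVec_le {S : Matrix (Fin n) (Fin n) ℝ} (hS : S.PosSemidef)
    (w : Fin n → ℝ) :
    ∃ t : ℝ, 0 < t ∧ ∀ s : ℝ, 0 ≤ s → s ≤ t → s • vecMulVec (S *ᵥ w) (S *ᵥ w) ≤ S := by
  have hc : 0 ≤ w ⬝ᵥ (S *ᵥ w) := by simpa using hS.dotProduct_mulVec_nonneg w
  have hsymm := isHermitian_iff_isSymm.mp hS.isHermitian
  -- Only `s * (wᵀ S w) ≤ 1` is needed; the `+ 1` covers `wᵀ S w = 0`.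
  refine ⟨(w ⬝ᵥ (S *ᵥ w) + 1)⁻¹, by positivity, fun s hs hst => ?_⟩
  have hsc : s * (w ⬝ᵥ (S *ᵥ w)) ≤ 1 := by
    have h := mul_le_mul_of_nonneg_right hst (by linarith : 0 ≤ w ⬝ᵥ (S *ᵥ w) + 1)
    rw [inv_mul_cancel₀ (by linarith)] at h
    nlinarith
  rw [Matrix.le_iff]
  refine .of_dotProduct_mulVec_nonneg ?_ fun x => ?_
  · rw [isHermitian_iff_isSymm, Matrix.IsSymm, transpose_sub, transpose_smul, transpose_vecMulVec,
      hsymm.eq]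
  -- With `a = xᵀSw` and `c = wᵀSw`, the form at this vector is `xᵀSx - 2sa² + s²a²c`, so `xᵀSx -
  -- sa² ≥ sa²(1 - sc) ≥ 0`.
  · have hq := hS.dotProduct_mulVec_nonneg (x - (s * (x ⬝ᵥ (S *ᵥ w))) • w)
    have hwx : w ⬝ᵥ (S *ᵥ x) = x ⬝ᵥ (S *ᵥ w) := by
      rw [dotProduct_mulVec, ← mulVec_transpose, hsymm.eq, dotProduct_comm]
    simp only [star_trivial, mulVec_sub, mulVec_smul, sub_dotProduct, dotProduct_sub,
      smul_dotProduct, dotProduct_smul, smul_eq_mul, hwx] at hq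
    have hx : star x ⬝ᵥ ((S - s • vecMulVec (S *ᵥ w) (S *ᵥ w)) *ᵥ x)
        = x ⬝ᵥ (S *ᵥ x) - s * (x ⬝ᵥ (S *ᵥ w)) ^ 2 := by
      rw [star_trivial, sub_mulVec, dotProduct_sub, smul_mulVec, dotProduct_smul,
        vecMulVec_mulVec, dotProduct_comm (S *ᵥ w) x]
      simp [sq]
    rw [hx]
    have : 0 ≤ s * (x ⬝ᵥ (S *ᵥ w)) ^ 2 * (1 - s * (w ⬝ᵥ (S *ᵥ w))) :=
      mul_nonneg (mul_nonneg hs (sq_nonneg _)) (by linarith)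
    nlinarith

/-! ### Minimal upper bounds as minimizers -/

lemma minimal_of_isMinimizer {𝒬 : Set (Matrix (Fin n) (Fin n) ℝ)}
    {C X : Matrix (Fin n) (Fin n) ℝ} (hC : C.PosDef) (h : IsMinimizer C 𝒬 X) :
    X ∈ minimalUpperBounds 𝒬 := by
  refine ⟨h.1, fun Z hZ hle => ?_⟩
  have h0 := eq_zero_of_frob_nonpos hC (Matrix.le_iff.mp hle)
    (by rw [frob_sub]; linarith [h.2 Z hZ])
  rw [sub_eq_zero.mp h0]

/-- For a minimal upper bound `X`, the kernels of the `X - A` span the whole space. -/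
lemma eq_zero_of_forall_mem_range {𝒬 : Set (Matrix (Fin n) (Fin n) ℝ)} (hfin : 𝒬.Finite)
    {X : Matrix (Fin n) (Fin n) ℝ} (hX : X ∈ minimalUpperBounds 𝒬) {v : Fin n → ℝ}
    (hv : ∀ A ∈ 𝒬, ∃ w, v = (X - A) *ᵥ w) : v = 0 := by
  -- Finiteness of `𝒬` yields one positive `s` that works for all `A`.
  have hev : ∀ᶠ s : ℝ in nhdsWithin 0 (Set.Ioi 0), ∀ A ∈ 𝒬, s • vecMulVec v v ≤ X - A := by
    rw [Filter.eventually_all_finite hfin]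
    intro A hA
    obtain ⟨w, rfl⟩ := hv A hA
    obtain ⟨t, ht, h⟩ := exists_smul_vecMulVec_le (Matrix.le_iff.mp (hX.1.2 A hA)) w
    filter_upwards [Ioc_mem_nhdsGT ht] with s hs using h s hs.1.le hs.2
  obtain ⟨s, hs, hpos⟩ := (hev.and self_mem_nhdsWithin).exists
  have hpos : 0 < s := hpos
  have hvv : (0 : Matrix (Fin n) (Fin n) ℝ) ≤ s • vecMulVec v v := by
    rw [Matrix.nonneg_iff_posSemidef]
    exact (by simpa using posSemidef_vecMulVec_self_star v :
      (vecMulVec v v).PosSemidef).smul hpos.le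
  have hZ : X - s • vecMulVec v v ∈ ub 𝒬 := by
    refine ⟨?_, fun A hA => le_sub_comm.mp (hs A hA)⟩
    rw [Matrix.IsSymm, transpose_sub, transpose_smul, transpose_vecMulVec, hX.1.1.eq]
  have hle : X ≤ X - s • vecMulVec v v := hX.2 hZ (sub_le_self X hvv)
  have h0 : s • vecMulVec v v = 0 :=
    le_antisymm ((le_sub_self_iff X).mp hle) hvv
  funext i
  have := congrFun (congrFun h0 i) i
  simpa [vecMulVec_apply, hpos.ne'] using this

lemma exists_isMinimizer_of_minimal {𝒬 : Set (Matrix (Fin n) (Fin n) ℝ)} (hfin : 𝒬.Finite)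
    (hsymm : ∀ A ∈ 𝒬, A.IsSymm) {X : Matrix (Fin n) (Fin n) ℝ}
    (hX : X ∈ minimalUpperBounds 𝒬) :
    ∃ C : Matrix (Fin n) (Fin n) ℝ, C.PosDef ∧ IsMinimizer C 𝒬 X := by
  choose! P T hP hPS hSP hST using fun A (hA : A ∈ 𝒬) =>
    exists_kernel_projection (hX.1.1.sub (hsymm A hA))
  have hmem : ∀ A ∈ hfin.toFinset, A ∈ 𝒬 := fun A hA => hfin.mem_toFinset.mp hA
  have hC : (∑ A ∈ hfin.toFinset, P A).PosSemidef :=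
    posSemidef_sum _ fun A hA => hP A (hmem A hA)
  refine ⟨∑ A ∈ hfin.toFinset, P A,
    .of_dotProduct_mulVec_pos hC.isHermitian fun x hx => ?_, hX.1, fun Z hZ => ?_⟩
  · refine lt_of_le_of_ne (hC.dotProduct_mulVec_nonneg x) fun h0 => hx ?_
    rw [sum_mulVec, dotProduct_sum, eq_comm, Finset.sum_eq_zero_iff_of_nonneg
      fun A hA => (hP A (hmem A hA)).dotProduct_mulVec_nonneg x] at h0
    -- If `xᵀCx = 0`, every `P A` kills `x`, so `x = (X - A) (T A) x` lies in every range.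
    refine eq_zero_of_forall_mem_range hfin hX fun A hA => ⟨T A *ᵥ x, ?_⟩
    have h1 := ((hP A hA).dotProduct_mulVec_zero_iff x).mp
      (h0 A (hfin.mem_toFinset.mpr hA))
    have h2 := congrArg (· *ᵥ x) (hST A hA)
    simpa [add_mulVec, h1] using h2.symm
  · have hlin : ∀ M, frob (∑ A ∈ hfin.toFinset, P A) M = ∑ A ∈ hfin.toFinset, frob (P A) M :=
      fun M => by simp [frob, Finset.sum_mul, trace_sum]
    rw [hlin, hlin]
    refine Finset.sum_le_sum fun A hA => ?_
    have h1 := frob_nonneg (hP A (hmem A hA)) (Matrix.le_iff.mp (hZ.2 A (hmem A hA)))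
    have h2 : frob (P A) (X - A) = 0 := by rw [frob, hPS A (hmem A hA), trace_zero]
    rw [frob_sub] at h1 h2
    linarith

/-! ### Uniqueness of the minimizer -/

lemma half_add_sub (X Y A : Matrix (Fin n) (Fin n) ℝ) :
    (1 / 2 : ℝ) • (X + Y) - A = (1 / 2 : ℝ) • ((X - A) + (Y - A)) := by
  module

/-- On the kernel of `S + T` two nonnegative quadratic forms add to zero, so both vanish, and a
semidefinite matrix kills the zeros of its form. -/
lemma mul_eq_zero_of_add_mul_eq_zero {S T P : Matrix (Fin n) (Fin n) ℝ} (hP : P.PosSemidef)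
    (hS : S.PosSemidef) (hT : T.PosSemidef) (h : (S + T) * P = 0) : P * S = 0 := by
  have hSP : S * P = 0 := by
    refine ext_of_mulVec_single fun i => ?_
    rw [zero_mulVec, ← mulVec_mulVec, ← hS.dotProduct_mulVec_zero_iff]
    set x := P *ᵥ Pi.single i 1
    have h0 : (S + T) *ᵥ x = 0 := by rw [mulVec_mulVec, h, zero_mulVec]
    have h1 : star x ⬝ᵥ (S *ᵥ x) + star x ⬝ᵥ (T *ᵥ x) = 0 := by
      rw [← dotProduct_add, ← add_mulVec, h0, dotProduct_zero]
    linarith [hS.dotProduct_mulVec_nonneg x, hT.dotProduct_mulVec_nonneg x]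
  have := congrArg transpose hSP
  rwa [transpose_mul, transpose_zero, isHermitian_iff_isSymm.mp hP.isHermitian,
    isHermitian_iff_isSymm.mp hS.isHermitian] at this

lemma isMinimizer_unique {𝒬 : Set (Matrix (Fin n) (Fin n) ℝ)} (hfin : 𝒬.Finite)
    (hsymm : ∀ A ∈ 𝒬, A.IsSymm) {C X Y : Matrix (Fin n) (Fin n) ℝ} (hC : C.PosDef)
    (hX : IsMinimizer C 𝒬 X) (hY : IsMinimizer C 𝒬 Y) : X = Y := by
  have hM : IsMinimizer C 𝒬 ((1 / 2 : ℝ) • (X + Y)) := by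
    refine ⟨⟨(hX.1.1.add hY.1.1).smul _, fun A hA => ?_⟩, fun Z hZ => ?_⟩
    · rw [Matrix.le_iff, half_add_sub]
      exact ((Matrix.le_iff.mp (hX.1.2 A hA)).add (Matrix.le_iff.mp (hY.1.2 A hA))).smul
        (by norm_num)
    · rw [frob_smul, frob_add]
      linarith [hX.2 Z hZ, hY.2 Z hZ]
  have hmin := minimal_of_isMinimizer hC hM
  have hcol : ∀ u, (X - Y) *ᵥ u = 0 := by
    intro u
    refine eq_zero_of_forall_mem_range hfin hmin fun A hA => ?_
    obtain ⟨P, T, hP, -, hSP, hST⟩ := exists_kernel_projection (hM.1.1.sub (hsymm A hA))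
    have hXA := Matrix.le_iff.mp (hX.1.2 A hA)
    have hYA := Matrix.le_iff.mp (hY.1.2 A hA)
    have hsum : ((X - A) + (Y - A)) * P = 0 := by
      rw [half_add_sub, Matrix.smul_mul] at hSP
      exact (smul_eq_zero.mp hSP).resolve_left (by norm_num)
    have h1 := mul_eq_zero_of_add_mul_eq_zero hP hXA hYA hsum
    have h2 := mul_eq_zero_of_add_mul_eq_zero hP hYA hXA (by rwa [add_comm])
    -- Since `P` projects onto the kernel of the midpoint minus `A`, this puts the columns of `X -
    -- Y` in the range of that matrix.
    have h3 : P * (X - Y) = 0 := by rw [← sub_sub_sub_cancel_right X Y A, Matrix.mul_sub, h1, h2,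
      sub_zero]
    refine ⟨(T * (X - Y)) *ᵥ u, ?_⟩
    rw [mulVec_mulVec, ← Matrix.mul_assoc]
    congr 1
    calc X - Y = (((1 / 2 : ℝ) • (X + Y) - A) * T + P) * (X - Y) := by rw [hST, Matrix.one_mul]
      _ = _ := by rw [Matrix.add_mul, h3, add_zero]
  exact sub_eq_zero.mp (ext_of_mulVec_single fun i => by rw [hcol, zero_mulVec])

/-! ### Existence of a minimizer -/

lemma ub_nonempty {𝒬 : Set (Matrix (Fin n) (Fin n) ℝ)} (hfin : 𝒬.Finite)
    (hsymm : ∀ A ∈ 𝒬, A.IsSymm) : (ub 𝒬).Nonempty := by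
  have hpos : ∀ A ∈ hfin.toFinset, A ≤ mabs A ∧ 0 ≤ mabs A := fun A hA => by
    obtain ⟨E, F, -, -, -, -, h, -, h'⟩ :=
      exists_mabs_decomposition (hsymm A (hfin.mem_toFinset.mp hA))
    exact ⟨h, h'⟩
  refine ⟨∑ A ∈ hfin.toFinset, mabs A, ?_, fun A hA => ?_⟩
  · rw [← isHermitian_iff_isSymm]
    exact (Matrix.nonneg_iff_posSemidef.mp
      (Finset.sum_nonneg fun A hA => (hpos A hA).2)).isHermitian
  · have hA' := hfin.mem_toFinset.mpr hA
    exact (hpos A hA').1.trans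
      (Finset.single_le_sum (f := mabs) (fun A hA => (hpos A hA).2) hA')

lemma isClosed_ub (𝒬 : Set (Matrix (Fin n) (Fin n) ℝ)) : IsClosed (ub 𝒬) := by
  have : ub 𝒬 = {X | Xᵀ = X} ∩ ⋂ A ∈ 𝒬, ({X | (X - A)ᴴ = X - A} ∩
      ⋂ x : Fin n → ℝ, {X | 0 ≤ star x ⬝ᵥ ((X - A) *ᵥ x)}) := by
    ext X
    simp [ub, Matrix.IsSymm, Matrix.le_iff, posSemidef_iff_dotProduct_mulVec, Matrix.IsHermitian]
  rw [this]
  refine (isClosed_eq (by fun_prop) (by fun_prop)).inter (isClosed_biInter fun A _ =>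
    (isClosed_eq (by fun_prop) (by fun_prop)).inter (isClosed_iInter fun x =>
      isClosed_le (by fun_prop) (by fun_prop)))

lemma exists_isMinimizer {𝒬 : Set (Matrix (Fin n) (Fin n) ℝ)} (hfin : 𝒬.Finite)
    (hne : 𝒬.Nonempty) (hsymm : ∀ A ∈ 𝒬, A.IsSymm) {C : Matrix (Fin n) (Fin n) ℝ}
    (hC : C.PosDef) : ∃ X, IsMinimizer C 𝒬 X := by
  obtain ⟨A₀, hA₀⟩ := hne
  obtain ⟨Z₀, hZ₀⟩ := ub_nonempty hfin hsymm
  obtain ⟨hB, hBC⟩ := exists_posDef_sqrt hC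
  set B := msqrt C
  have hdet := (Matrix.isUnit_iff_isUnit_det B).mp hB.isUnit
  set r := frob C (Z₀ - A₀)
  let box : Set (Matrix (Fin n) (Fin n) ℝ) :=
    Set.univ.pi fun _ => Set.univ.pi fun _ => Set.Icc (-r) r
  have hbox : IsCompact box := isCompact_univ_pi fun _ => isCompact_univ_pi fun _ => isCompact_Icc
  have hK : IsCompact (((fun N => A₀ + B⁻¹ * N * B⁻¹) '' box) ∩ ub 𝒬) :=
    (hbox.image (by fun_prop)).inter_right (isClosed_ub 𝒬)
  have hmem : ∀ Z ∈ ub 𝒬, frob C Z ≤ frob C Z₀ →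
      Z ∈ ((fun N => A₀ + B⁻¹ * N * B⁻¹) '' box) ∩ ub 𝒬 := by
    -- `B * (Z - A₀) * B` is positive semidefinite of trace at most `r`, so its entries lie in `[-r,
    -- r]`.
    intro Z hZ hle
    refine ⟨⟨B * (Z - A₀) * B, ?_, ?_⟩, hZ⟩
    · have hp := posSemidef_conj (Matrix.le_iff.mp (hZ.2 A₀ hA₀)) B
      rw [transpose_eq_of_posDef hB] at hp
      have htr : (B * (Z - A₀) * B).trace ≤ r := by
        rw [← frob_mul_self, hBC, frob_sub]
        simp only [r, frob_sub]
        linarith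
      intro i _ j _
      exact abs_le.mp ((abs_apply_le_trace hp i j).trans htr)
    · simp only [Matrix.mul_assoc, mul_nonsing_inv B hdet, Matrix.mul_one,
        nonsing_inv_mul_cancel_left B _ hdet]
      abel
  have hcont : Continuous (frob C) := by
    unfold frob
    fun_prop
  obtain ⟨X, hX, hmin⟩ := hK.exists_isMinOn ⟨Z₀, hmem Z₀ hZ₀ le_rfl⟩ hcont.continuousOn
  refine ⟨X, hX.2, fun Z hZ => ?_⟩
  rcases le_total (frob C Z) (frob C Z₀) with h | h
  · exact hmin (hmem Z hZ h)
  · exact (hmin (hmem Z₀ hZ₀ le_rfl)).trans h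

/-! ### The formula for two matrices -/

lemma isMinimizer_pair {P Q C : Matrix (Fin n) (Fin n) ℝ} (hP : P.IsSymm) (hQ : Q.IsSymm)
    (hC : C.PosDef) :
    IsMinimizer C {P, Q} ((1 / 2 : ℝ) • (P + Q) +
      (1 / 2 : ℝ) • ((msqrt C)⁻¹ * mabs (msqrt C * (P - Q) * msqrt C) * (msqrt C)⁻¹)) := by
  obtain ⟨hB, hBC⟩ := exists_posDef_sqrt hC
  set B := msqrt C
  have hdet := (Matrix.isUnit_iff_isUnit_det B).mp hB.isUnit
  have hBT := transpose_eq_of_posDef hB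
  have hBiT : (B⁻¹)ᵀ = B⁻¹ := transpose_eq_of_posDef hB.inv
  have hD : (B * (P - Q) * B).IsSymm := by
    rw [Matrix.IsSymm, transpose_mul, transpose_mul, (hP.sub hQ).eq, hBT, Matrix.mul_assoc]
  obtain ⟨E, F, hE, hF, hEF, habs, hle, hle', -⟩ := exists_mabs_decomposition hD
  set N := mabs (B * (P - Q) * B)
  have hcancel : ∀ M, B⁻¹ * (B * M * B) * B⁻¹ = M := fun M => by
    simp only [Matrix.mul_assoc, mul_nonsing_inv B hdet, Matrix.mul_one,
      nonsing_inv_mul_cancel_left B _ hdet]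
  have hcancel' : B * (B⁻¹ * N * B⁻¹) * B = N := by
    simp only [Matrix.mul_assoc, nonsing_inv_mul B hdet, Matrix.mul_one,
      mul_nonsing_inv_cancel_left B _ hdet]
  -- With `D = B * (P - Q) * B`, the difference is half of `B⁻¹ * (|D| - D) * B⁻¹`; for `Q` the sign
  -- of `D` flips.
  have hXP : ((1 / 2 : ℝ) • (P + Q) + (1 / 2 : ℝ) • (B⁻¹ * N * B⁻¹) - P).PosSemidef := by
    have h := (posSemidef_conj (Matrix.le_iff.mp hle) B⁻¹).smul (by norm_num : (0 : ℝ) ≤ 1 / 2)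
    rw [hBiT, Matrix.mul_sub, Matrix.sub_mul, hcancel] at h
    convert h using 1
    module
  have hXQ : ((1 / 2 : ℝ) • (P + Q) + (1 / 2 : ℝ) • (B⁻¹ * N * B⁻¹) - Q).PosSemidef := by
    have h := (posSemidef_conj (Matrix.le_iff.mp hle') B⁻¹).smul (by norm_num : (0 : ℝ) ≤ 1 / 2)
    rw [hBiT, sub_neg_eq_add, Matrix.mul_add, Matrix.add_mul, hcancel] at h
    convert h using 1
    module
  refine ⟨⟨?_, ?_⟩, fun Z hZ => ?_⟩
  · simpa using (isHermitian_iff_isSymm.mp hXP.isHermitian).add hP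
  · rintro A (rfl | rfl)
    · exact hXP
    · exact hXQ
  · have hPZ := posSemidef_conj (Matrix.le_iff.mp (hZ.2 P (by simp))) B
    have hQZ := posSemidef_conj (Matrix.le_iff.mp (hZ.2 Q (by simp))) B
    rw [hBT] at hPZ hQZ
    -- As `E + F = 1`, these two give `frob C Z ≥ frob E (BPB) + frob F (BQB)`. By `|D| = ED - FD`,
    -- the right side is the value at the claimed minimizer.
    have h1 := frob_nonneg hE hPZ
    have h2 := frob_nonneg hF hQZ
    have hN : N.trace = frob E (B * (Z - Q) * B) - frob E (B * (Z - P) * B)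
        - (frob F (B * (Z - Q) * B) - frob F (B * (Z - P) * B)) := by
      have hsub : B * (P - Q) * B = B * (Z - Q) * B - B * (Z - P) * B := by noncomm_ring
      rw [habs, ← frob_sub, ← frob_sub, ← hsub, trace_sub, frob, frob]
    have hEF' : ∀ M, frob E M + frob F M = M.trace := fun M => by
      rw [frob, frob, ← trace_add, ← Matrix.add_mul, hEF, Matrix.one_mul]
    have h3 := hEF' (B * (Z - P) * B)
    have h4 := hEF' (B * (Z - Q) * B)
    rw [← frob_mul_self, hBC, frob_sub] at h3 h4
    have h5 : frob C (B⁻¹ * N * B⁻¹) = N.trace := by rw [← hBC, frob_mul_self, hcancel']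
    rw [frob_add, frob_smul, frob_smul, frob_add, h5]
    linarith

end Loewner

theorem mainTheorem5 (n : ℕ) :
    (∀ 𝒬 : Set (Matrix (Fin n) (Fin n) ℝ), 𝒬.Finite → (∀ A ∈ 𝒬, A.IsSymm) →
      (∀ X : Matrix (Fin n) (Fin n) ℝ,
        X ∈ Loewner.minimalUpperBounds 𝒬 ↔
          ∃ C : Matrix (Fin n) (Fin n) ℝ, C.PosDef ∧ Loewner.IsMinimizer C 𝒬 X) ∧
      (𝒬.Nonempty → ∀ C : Matrix (Fin n) (Fin n) ℝ, C.PosDef →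
        ∃! X : Matrix (Fin n) (Fin n) ℝ, Loewner.IsMinimizer C 𝒬 X)) ∧
    (∀ P Q C : Matrix (Fin n) (Fin n) ℝ, P.IsSymm → Q.IsSymm → C.PosDef →
      ∀ X : Matrix (Fin n) (Fin n) ℝ, Loewner.IsMinimizer C {P, Q} X ↔
        X = (1 / 2 : ℝ) • (P + Q) +
          (1 / 2 : ℝ) • ((Loewner.msqrt C)⁻¹ *
            Loewner.mabs (Loewner.msqrt C * (P - Q) * Loewner.msqrt C) *
              (Loewner.msqrt C)⁻¹)) := by
  refine ⟨fun 𝒬 hfin hsymm => ⟨fun X => ⟨fun hX => ?_, ?_⟩, fun hne C hC => ?_⟩, ?_⟩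
  · exact Loewner.exists_isMinimizer_of_minimal hfin hsymm hX
  · rintro ⟨C, hC, h⟩
    exact Loewner.minimal_of_isMinimizer hC h
  · obtain ⟨X, hX⟩ := Loewner.exists_isMinimizer hfin hne hsymm hC
    exact ⟨X, hX, fun Y hY => Loewner.isMinimizer_unique hfin hsymm hC hY hX⟩
  · intro P Q C hP hQ hC X
    have h := Loewner.isMinimizer_pair hP hQ hC
    refine ⟨fun hX => ?_, fun hX => hX ▸ h⟩
    refine Loewner.isMinimizer_unique (Set.toFinite _) ?_ hC hX h
    rintro A (rfl | rfl) <;> assumption
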